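/- Let $n,r\ge 0$ be integers. Let $\mathrm{GL}(n,\mathbb C)$ act on $\mathfrak{gl}(n,\mathbb C)^{\times r}$ (all $r$-tuples of complex $n\times n$ matrices), and $\mathrm{SL}(n,\mathbb C)$ on $\mathrm{SL}(n,\mathbb C)^{\times r}$, by simultaneous conjugation $g\cdot(X_1,\dots,X_r)=(gX_1g^{-1},\dots,gX_rg^{-1})$. For an affine variety $Y$ with an action of a group $G$, let $\mathbb C[Y/\!\!/G]=\mathbb C[Y]^G$ denote the ring of $G$-invariant polynomial functions on $Y$. For an $n\times n$ matrix $X$ define recursively $$C^0(X)=1,\qquad C^m(X)=\frac1m\sum_{k=1}^m(-1)^{k+1}C^{m-k}(X)\,\mathrm{tr}(X^k)\quad(m\ge1),$$ and put $$P(X)=(-1)^{n+1}n+\sum_{k=1}^{n-1}(-1)^{n+k+1}C^{n-k}(X)\,\mathrm{tr}(X^k).$$ Then restriction of functions from $\mathfrak{gl}(n,\mathbb C)^{\times r}$ to $\mathrm{SL}(n,\mathbb C)^{\times r}$ induces an isomorphism of $\mathbb C$-algebras $$\mathbb C[\mathfrak{gl}(n,\mathbb C)^{\times r}/\!\!/\mathrm{GL}(n,\mathbb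 C)]\,/\,\mathfrak I\;\cong\;\mathbb C[\mathrm{SL}(n,\mathbb C)^{\times r}/\!\!/\mathrm{SL}(n,\mathbb C)],$$ where $\mathfrak I=\big(\mathrm{tr}(X_1^n)-P(X_1),\dots,\mathrm{tr}(X_r^n)-P(X_r)\big)$ is the ideal generated in $\mathbb C[\mathfrak{gl}(n,\mathbb C)^{\times r}/\!\!/\mathrm{GL}(n,\mathbb C)]$. Moreover, for every complex $n\times n$ matrix $X$, $$P(X)=\mathrm{tr}(X^n)+(-1)^n\,n\,(\det X-1)\qquad\text{and}\qquad \det(tI-X)=\sum_{k=0}^n(-1)^{n-k}C^{n-k}(X)\,t^k,$$ and $P(X)$ is a polynomial (the same for all $X$) in $\mathrm{tr}(X),\dots,\mathrm{tr}(X^{n-1})$, as well as a polynomial in the coefficients of the characteristic polynomial of $X$. -/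

import Mathlib

namespace MatrixInvariants

open Matrix

/-- The ring of polynomial functions on a set `Y` that is placed in affine space by the coordinate
functions `c s : Y → ℂ`, `s ∈ σ`: the functions on `Y` that are polynomials in the `c s`. -/
noncomputable def coordinateRing {σ Y : Type} (c : σ → Y → ℂ) : Subalgebra ℂ (Y → ℂ) :=
  (MvPolynomial.aeval c : MvPolynomial σ ℂ →ₐ[ℂ] (Y → ℂ)).range

/-- The functions on `Y` that are invariant under an action of `G` on `Y`, given as a map. -/
def invariantFunctions {G Y : Type} (act : G → Y → Y) : Subalgebra ℂ (Y → ℂ) where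
  carrier := {f | ∀ g y, f (act g y) = f y}
  mul_mem' hf hg a y := by simp [hf a y, hg a y]
  add_mem' hf hg a y := by simp [hf a y, hg a y]
  algebraMap_mem' _ _ _ := rfl

/-- `gl(n, ℂ)^r`. -/
abbrev GlTuple (n r : ℕ) : Type := Fin r → Matrix (Fin n) (Fin n) ℂ

/-- `SL(n, ℂ)^r`. -/
abbrev SLTuple (n r : ℕ) : Type := Fin r → SpecialLinearGroup (Fin n) ℂ

/-- The matrix entry `x_{ij}^k` as a function on `gl(n, ℂ)^r`, for `s = (k, i, j)`. -/
def glCoord (n r : ℕ) (s : Fin r × Fin n × Fin n) (X : GlTuple n r) : ℂ :=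
  X s.1 s.2.1 s.2.2

/-- The matrix entry `x_{ij}^k` as a function on `SL(n, ℂ)^r`, for `s = (k, i, j)`. -/
def slCoord (n r : ℕ) (s : Fin r × Fin n × Fin n) (X : SLTuple n r) : ℂ :=
  (X s.1 : Matrix (Fin n) (Fin n) ℂ) s.2.1 s.2.2

/-- Simultaneous conjugation of `GL(n, ℂ)` on `gl(n, ℂ)^r`. -/
def glConj (n r : ℕ) (g : GL (Fin n) ℂ) (X : GlTuple n r) : GlTuple n r :=
  fun k => (g : Matrix (Fin n) (Fin n) ℂ) * X k * ((g⁻¹ : GL (Fin n) ℂ) : Matrix (Fin n) (Fin n) ℂ)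

/-- Simultaneous conjugation of `SL(n, ℂ)` on `SL(n, ℂ)^r`. -/
def slConj (n r : ℕ) (g : SpecialLinearGroup (Fin n) ℂ) (X : SLTuple n r) : SLTuple n r :=
  fun k => g * X k * g⁻¹

/-- `ℂ[gl(n, ℂ)^r // GL(n, ℂ)]`, the ring of `GL(n, ℂ)`-invariant polynomial functions on
`gl(n, ℂ)^r`. -/
noncomputable abbrev GlQuotientRing (n r : ℕ) : Subalgebra ℂ (GlTuple n r → ℂ) :=
  coordinateRing (glCoord n r) ⊓ invariantFunctions (glConj n r)

/-- `ℂ[SL(n, ℂ)^r // SL(n, ℂ)]`, the ring of `SL(n, ℂ)`-invariant polynomial functions on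
`SL(n, ℂ)^r`. -/
noncomputable abbrev SLQuotientRing (n r : ℕ) : Subalgebra ℂ (SLTuple n r → ℂ) :=
  coordinateRing (slCoord n r) ⊓ invariantFunctions (slConj n r)

/-- The polynomials `C_0^m` in a sequence `p` (in the application, `p k = tr(X^k)`):
`C_0^0 = 1` and `C_0^m = (1/m) ∑_{k=1}^m (-1)^{k+1} C_0^{m-k} p_k`; the sum below is over `k - 1`. -/
noncomputable def newtonC {A : Type} [CommRing A] [Algebra ℂ A] (p : ℕ → A) : ℕ → A
  | 0 => 1
  | m + 1 => ((m : ℂ) + 1)⁻¹ •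
      ∑ k : Fin (m + 1), (-1) ^ (k : ℕ) * newtonC p (m - (k : ℕ)) * p ((k : ℕ) + 1)
  termination_by m => m
  decreasing_by omega

/-- `P = (-1)^{n+1} n + ∑_{k=1}^{n-1} (-1)^{n+k+1} C_0^{n-k} p_k`. -/
noncomputable def newtonP {A : Type} [CommRing A] [Algebra ℂ A] (n : ℕ) (p : ℕ → A) : A :=
  (-1) ^ (n + 1) * (n : A) +
    ∑ k ∈ Finset.Ico 1 n, (-1) ^ (n + k + 1) * newtonC p (n - k) * p k

/-- The sequence `k ↦ tr(X^k)` of a matrix. -/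
noncomputable def powTrace {n : ℕ} (X : Matrix (Fin n) (Fin n) ℂ) (k : ℕ) : ℂ := (X ^ k).trace

theorem powTrace_mem (n r : ℕ) (k : Fin r) (m : ℕ) :
    (fun X : GlTuple n r => powTrace (X k) m) ∈ GlQuotientRing n r := by
  refine ⟨?_, ?_⟩
  · have h : ∀ m (i j : Fin n),
        (fun X : GlTuple n r => ((X k) ^ m) i j) ∈ coordinateRing (glCoord n r) := by
      intro m
      induction m with
      | zero =>
        intro i j
        exact (coordinateRing (glCoord n r)).algebraMap_mem
          ((1 : Matrix (Fin n) (Fin n) ℂ) i j)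
      | succ m ih =>
        intro i j
        have : (fun X : GlTuple n r => ((X k) ^ (m + 1)) i j) =
            ∑ l, (fun X : GlTuple n r => ((X k) ^ m) i l) * glCoord n r (k, l, j) := by
          funext X
          simp [pow_succ, Matrix.mul_apply, glCoord]
        rw [this]
        exact Subalgebra.sum_mem _ fun l _ => Subalgebra.mul_mem _ (ih i l)
          ⟨MvPolynomial.X (k, l, j), by simp⟩
    have e : (fun X : GlTuple n r => powTrace (X k) m) =
        ∑ i, fun X : GlTuple n r => ((X k) ^ m) i i := by
      funext X
      simp [powTrace, Matrix.trace]
    rw [e]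
    exact Subalgebra.sum_mem _ fun i _ => h m i i
  · intro g X
    simp only [glConj, powTrace]
    rw [Units.conj_pow, Matrix.trace_units_conj]

/-- `tr(X_k^m)` as an element of `ℂ[gl(n, ℂ)^r // GL(n, ℂ)]`. -/
noncomputable def tracePow (n r : ℕ) (k : Fin r) (m : ℕ) : GlQuotientRing n r :=
  ⟨fun X => powTrace (X k) m, powTrace_mem n r k m⟩

/-- The ideal `(tr(X_1^n) - P(X_1), …, tr(X_r^n) - P(X_r))` of `ℂ[gl(n, ℂ)^r // GL(n, ℂ)]`. -/
noncomputable def unimodularIdeal (n r : ℕ) : Ideal (GlQuotientRing n r) :=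
  Ideal.span (Set.range fun k : Fin r => tracePow n r k n - newtonP n (tracePow n r k))

end MatrixInvariants

/-!
The identity `det q(X) = ∏ q(a)`, the product being over the roots `a` of the characteristic
polynomial, shows that the roots of the characteristic polynomial of `q(X)` are the `q(a)`. Hence
`tr(X^k)` is the `k`-th power sum of the roots, and Newton's identities turn the recursion for `C^m`
into that of the elementary symmetric functions. In particular, for `n > 0`,
`tr(X^n) - P(X)` is a nonzero multiple of `det X - 1`, so that `det X_k = 1` modulo the ideal.

Let `t ∈ ℂ^r` act on `gl(n, ℂ)^r` by scaling each matrix. A polynomial function is a sum of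
multihomogeneous ones, and `det X_k` has degree `n` in `t_k` and degree `0` in the other variables.
Multiplying each component by powers of the determinants therefore changes the function neither
modulo the ideal nor on `SL(n, ℂ)^r`, and moves all multidegrees into a box
`∏ [n M_k, n M_k + n)`. Scalings by `n`-th roots of unity preserve `SL(n, ℂ)^r`, and a polynomial of
degree less than `n` in each variable is determined by its values at tuples of `n`-th roots of
unity; since every invertible matrix is a multiple of a unimodular one, a function with multidegrees
in the box is determined by its values on `SL(n, ℂ)^r`. If it vanishes there it is zero, which gives
the kernel of the restriction; if its values there are invariant then it is itself invariant, which
gives the surjectivity.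
-/

namespace MatrixInvariants

open Matrix

section SpectralMapping

open Polynomial

variable {ι K : Type*} [Fintype ι] [DecidableEq ι] [Field K] [IsAlgClosed K]

theorem card_roots_charpoly (X : Matrix ι ι K) : X.charpoly.roots.card = Fintype.card ι := by
  rw [← (IsAlgClosed.splits X.charpoly).natDegree_eq_card_roots, charpoly_natDegree_eq_dim]

theorem det_aeval_X_add_C (X : Matrix ι ι K) (a : K) :
    (aeval X (Polynomial.X + C a)).det = (X.charpoly.roots.map (· + a)).prod := by
  have eq_neg : aeval X (Polynomial.X + C a) = -(scalar ι (-a) - X) := by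
    simp [algebraMap_eq_diagonal, Pi.algebraMap_def, ← diagonal_neg]
  rw [eq_neg, det_neg, ← eval_charpoly,
    (IsAlgClosed.splits X.charpoly).eval_eq_prod_roots_of_monic X.charpoly_monic,
    ← card_roots_charpoly X, ← Multiset.card_map (-a - ·), ← Multiset.prod_map_neg,
    Multiset.map_map]
  simp [add_comm]

theorem det_aeval_eq_prod_roots_charpoly (X : Matrix ι ι K) (q : K[X]) :
    (aeval X q).det = (X.charpoly.roots.map fun a => q.eval a).prod := by
  induction IsAlgClosed.splits q using Submonoid.closure_induction with
  | mem q hq =>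
    rcases hq with ⟨a, rfl⟩ | ⟨a, rfl⟩
    · simp [algebraMap_eq_diagonal, card_roots_charpoly]
    · simpa using det_aeval_X_add_C X a
  | one => simp
  | mul p q _ _ hp hq => simp only [map_mul, det_mul, hp, hq, eval_mul, Multiset.prod_map_mul]

theorem charpoly_aeval (X : Matrix ι ι K) (q : K[X]) :
    (aeval X q).charpoly = ((X.charpoly.roots.map q.eval).map (Polynomial.X - C ·)).prod := by
  refine Polynomial.funext fun b => ?_
  have det_eq := det_aeval_eq_prod_roots_charpoly X (C b - q)
  rw [eval_charpoly, eval_multiset_prod, Multiset.map_map, Multiset.map_map]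
  simpa [algebraMap_eq_diagonal, Function.comp_def, Pi.algebraMap_def] using det_eq

theorem trace_aeval_eq_sum_roots_charpoly (X : Matrix ι ι K) (q : K[X]) :
    (aeval X q).trace = (X.charpoly.roots.map fun a => q.eval a).sum := by
  rw [trace_eq_sum_roots_charpoly, charpoly_aeval, roots_multiset_prod_X_sub_C]

end SpectralMapping

section Newton

variable {A : Type} [CommRing A] [Algebra ℂ A]

theorem newtonC_zero (p : ℕ → A) : newtonC p 0 = 1 := by
  rw [newtonC]

theorem succ_mul_newtonC (p : ℕ → A) (m : ℕ) :
    ((m : A) + 1) * newtonC p (m + 1) =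
      ∑ k ∈ Finset.range (m + 1), (-1) ^ k * newtonC p (m - k) * p (k + 1) := by
  have cast_eq : (m : A) + 1 = algebraMap ℂ A (m + 1) := by simp
  rw [newtonC, ← Finset.sum_range fun k => (-1) ^ k * newtonC p (m - k) * p (k + 1), cast_eq,
    ← Algebra.smul_def, smul_inv_smul₀ (Nat.cast_add_one_ne_zero m)]

theorem isUnit_natCast_add_one (m : ℕ) : IsUnit ((m : A) + 1) := by
  simpa using (Nat.cast_add_one_ne_zero (R := ℂ) m).isUnit.map (algebraMap ℂ A)

theorem eq_newtonC {p c : ℕ → A} (zero : c 0 = 1)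
    (succ : ∀ m : ℕ, ((m : A) + 1) * c (m + 1) =
      ∑ k ∈ Finset.range (m + 1), (-1) ^ k * c (m - k) * p (k + 1)) (m : ℕ) :
    c m = newtonC p m := by
  induction m using Nat.strong_induction_on with
  | _ m ih =>
    cases m with
    | zero => rw [zero, newtonC_zero]
    | succ m =>
      rw [← (isUnit_natCast_add_one (A := A) m).mul_right_inj, succ, succ_mul_newtonC]
      exact Finset.sum_congr rfl fun k _ => by rw [ih (m - k) (by omega)]

theorem map_newtonC {B : Type} [CommRing B] [Algebra ℂ B] (φ : A →ₐ[ℂ] B) (p : ℕ → A) (m : ℕ) :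
    φ (newtonC p m) = newtonC (fun k => φ (p k)) m :=
  eq_newtonC (c := fun m => φ (newtonC p m)) (by simp [newtonC_zero])
    (fun m => by simpa using congrArg φ (succ_mul_newtonC p m)) m

theorem map_newtonP {B : Type} [CommRing B] [Algebra ℂ B] (φ : A →ₐ[ℂ] B) (n : ℕ) (p : ℕ → A) :
    φ (newtonP n p) = newtonP n fun k => φ (p k) := by
  simp [newtonP, map_newtonC]

theorem newtonP_succ (n : ℕ) (p : ℕ → A) :
    newtonP (n + 1) p =
      p (n + 1) + (-1) ^ (n + 1) * ((n : A) + 1) * (newtonC p (n + 1) - 1) := by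
  have neg_one_sq : (-1 : A) ^ n * (-1) ^ n = 1 := by rw [← mul_pow]; simp
  have sum_eq : ∑ k ∈ Finset.Ico 1 (n + 1), (-1) ^ (n + 1 + k + 1) * newtonC p (n + 1 - k) * p k =
      (-1) ^ (n + 1) * ∑ k ∈ Finset.range n, (-1) ^ k * newtonC p (n - k) * p (k + 1) := by
    rw [Finset.sum_Ico_eq_sum_range, Finset.mul_sum]
    refine Finset.sum_congr rfl fun k _ => ?_
    rw [add_comm 1 k, Nat.add_sub_add_right]
    ring
  have recursion := succ_mul_newtonC p n
  rw [Finset.sum_range_succ, Nat.sub_self, newtonC_zero] at recursion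
  rw [newtonP, sum_eq]
  push_cast
  linear_combination (-1) ^ n * recursion + p (n + 1) * neg_one_sq

theorem newtonC_psum (σ : Type) [Fintype σ] (m : ℕ) :
    newtonC (MvPolynomial.psum σ ℂ) m = MvPolynomial.esymm σ ℂ m := by
  refine (eq_newtonC (c := MvPolynomial.esymm σ ℂ) (by simp) (fun m => ?_) m).symm
  have newton := MvPolynomial.mul_esymm_eq_sum σ ℂ (m + 1)
  rw [Finset.sum_filter, Finset.Nat.sum_antidiagonal_succ', if_neg (by simp), zero_add,
    ← Finset.Nat.sum_antidiagonal_swap, Finset.Nat.sum_antidiagonal_eq_sum_range_succ_mk] at newton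
  push_cast at newton
  rw [newton, Finset.mul_sum]
  refine Finset.sum_congr rfl fun k hk => ?_
  have hkm : k ≤ m := Nat.lt_succ_iff.mp (Finset.mem_range.mp hk)
  have sign_eq : (-1 : MvPolynomial σ ℂ) ^ (m + 1 + 1) * (-1) ^ (m - k) = (-1) ^ k := by
    rw [← pow_add, show m + 1 + 1 + (m - k) = k + 2 * (m - k + 1) by omega, pow_add, pow_mul]
    simp
  simp only [Prod.swap_prod_mk]
  rw [if_pos (by omega), ← mul_assoc, ← mul_assoc, sign_eq]

theorem newtonC_sum_pow (s : Multiset ℂ) (m : ℕ) :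
    newtonC (fun k => (s.map (· ^ k)).sum) m = s.esymm m := by
  have aeval_psum (k : ℕ) : MvPolynomial.aeval (fun x : s => (x : ℂ)) (MvPolynomial.psum s ℂ k) =
      (s.map (· ^ k)).sum := by
    simp only [MvPolynomial.psum, map_sum, map_pow, MvPolynomial.aeval_X]
    exact congrArg Multiset.sum (Multiset.map_univ s (· ^ k))
  simpa only [newtonC_psum, MvPolynomial.aeval_esymm_eq_multiset_esymm, Multiset.map_univ_coe,
    aeval_psum, eq_comm] using
    map_newtonC (MvPolynomial.aeval fun x : s => (x : ℂ)) (MvPolynomial.psum s ℂ) m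

theorem newtonC_mem {S : Subalgebra ℂ A} {p : ℕ → A} {m : ℕ} (hp : ∀ k < m, p (k + 1) ∈ S) :
    newtonC p m ∈ S := by
  induction m using Nat.strong_induction_on with
  | _ m ih =>
    cases m with
    | zero => exact newtonC_zero p ▸ one_mem S
    | succ m =>
      rw [newtonC]
      refine S.smul_mem (sum_mem fun k _ => mul_mem (mul_mem ?_ ?_) (hp _ (by omega))) _
      · exact pow_mem (neg_mem (one_mem S)) _
      · exact ih _ (by omega) fun j hj => hp j (by omega)

theorem newtonP_mem {S : Subalgebra ℂ A} {p : ℕ → A} {n : ℕ}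
    (hp : ∀ k, k + 1 < n → p (k + 1) ∈ S) : newtonP n p ∈ S := by
  refine add_mem (mul_mem (pow_mem (neg_mem (one_mem S)) _) (natCast_mem S n))
    (sum_mem fun k hk => ?_)
  obtain ⟨one_le_k, k_lt⟩ := Finset.mem_Ico.mp hk
  obtain ⟨k, rfl⟩ := Nat.exists_eq_add_of_le' one_le_k
  exact mul_mem (mul_mem (pow_mem (neg_mem (one_mem S)) _)
    (newtonC_mem fun j hj => hp j (by omega))) (hp k k_lt)

theorem mem_of_newtonC_mem {S : Subalgebra ℂ A} {p : ℕ → A} {n : ℕ}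
    (hc : ∀ j ≤ n, newtonC p j ∈ S) {m : ℕ} (hm : m < n) : p (m + 1) ∈ S := by
  induction m using Nat.strong_induction_on with
  | _ m ih =>
    have neg_one_pow_mem (k : ℕ) : (-1 : A) ^ k ∈ S := pow_mem (neg_mem (one_mem S)) k
    have recursion := succ_mul_newtonC p m
    rw [Finset.sum_range_succ, Nat.sub_self, newtonC_zero, mul_one] at recursion
    have signed_mem : (-1) ^ m * p (m + 1) ∈ S := by
      rw [eq_sub_of_add_eq' recursion.symm]
      refine sub_mem (mul_mem (add_mem (natCast_mem S m) (one_mem S)) (hc _ hm))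
        (sum_mem fun k hk => ?_)
      have hkm := Finset.mem_range.mp hk
      exact mul_mem (mul_mem (neg_one_pow_mem k) (hc _ (by omega))) (ih k hkm (by omega))
    simpa [← mul_assoc, ← mul_pow] using mul_mem (neg_one_pow_mem m) signed_mem

end Newton

section Characteristic

variable {n : ℕ}

theorem newtonC_powTrace_eq_esymm (X : Matrix (Fin n) (Fin n) ℂ) (m : ℕ) :
    newtonC (powTrace X) m = X.charpoly.roots.esymm m := by
  have powTrace_eq : powTrace X = fun k => (X.charpoly.roots.map (· ^ k)).sum :=
    funext fun k => by simpa [powTrace] using trace_aeval_eq_sum_roots_charpoly X (Polynomial.X ^ k)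
  rw [powTrace_eq, newtonC_sum_pow]

theorem charpoly_coeff_eq_newtonC (X : Matrix (Fin n) (Fin n) ℂ) {k : ℕ} (hk : k ≤ n) :
    X.charpoly.coeff k = (-1) ^ (n - k) * newtonC (powTrace X) (n - k) := by
  have natDegree_eq : X.charpoly.natDegree = n := by simp
  have card_roots : X.charpoly.roots.card = X.charpoly.natDegree := by
    rw [card_roots_charpoly, charpoly_natDegree_eq_dim]
  rw [Polynomial.coeff_eq_esymm_roots_of_card card_roots (by rwa [natDegree_eq]), natDegree_eq,
    newtonC_powTrace_eq_esymm, X.charpoly_monic.leadingCoeff, one_mul]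

theorem newtonC_powTrace_sub (X : Matrix (Fin n) (Fin n) ℂ) {k : ℕ} (hk : k ≤ n) :
    newtonC (powTrace X) (n - k) = (-1) ^ (n - k) * X.charpoly.coeff k := by
  rw [charpoly_coeff_eq_newtonC X hk, ← mul_assoc, ← mul_pow]
  simp

theorem newtonC_powTrace_card (X : Matrix (Fin n) (Fin n) ℂ) :
    newtonC (powTrace X) n = X.det := by
  simpa [det_eq_sign_charpoly_coeff] using newtonC_powTrace_sub X (Nat.zero_le n)

theorem newtonP_powTrace (X : Matrix (Fin n) (Fin n) ℂ) :
    newtonP n (powTrace X) = (X ^ n).trace + (-1) ^ n * (n : ℂ) * (X.det - 1) := by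
  cases n with
  | zero => simp [newtonP, Matrix.trace]
  | succ n => rw [newtonP_succ, newtonC_powTrace_card, powTrace, Nat.cast_succ]

end Characteristic

section CoordinateRing

variable {σ τ Y Z : Type} {c : σ → Y → ℂ}

theorem aeval_apply_eq_eval (c : σ → Y → ℂ) (p : MvPolynomial σ ℂ) (y : Y) :
    MvPolynomial.aeval c p y = MvPolynomial.eval (fun s => c s y) p := by
  rw [← MvPolynomial.aeval_eq_eval]
  exact MvPolynomial.comp_aeval_apply c (Pi.evalAlgHom ℂ (fun _ : Y => ℂ) y) p

theorem mem_coordinateRing_iff {f : Y → ℂ} :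
    f ∈ coordinateRing c ↔ ∃ p, ∀ y, f y = MvPolynomial.eval (fun s => c s y) p := by
  simp only [coordinateRing, AlgHom.mem_range, funext_iff, aeval_apply_eq_eval, eq_comm]

theorem coord_mem_coordinateRing (c : σ → Y → ℂ) (s : σ) : c s ∈ coordinateRing c :=
  ⟨MvPolynomial.X s, MvPolynomial.aeval_X c s⟩

/-- Composition with a map, as an algebra homomorphism between rings of functions. -/
def pullback {Y Z : Type*} (φ : Z → Y) : (Y → ℂ) →ₐ[ℂ] (Z → ℂ) :=
  AlgHom.pi fun z => Pi.evalAlgHom ℂ (fun _ => ℂ) (φ z)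

theorem comp_mem_coordinateRing {d : τ → Z → ℂ} {φ : Z → Y}
    (hφ : ∀ s, c s ∘ φ ∈ coordinateRing d) {f : Y → ℂ} (hf : f ∈ coordinateRing c) :
    f ∘ φ ∈ coordinateRing d := by
  suffices coordinateRing c ≤ (coordinateRing d).comap (pullback φ) from this hf
  rw [coordinateRing, ← Algebra.adjoin_range_eq_range_aeval, Algebra.adjoin_le_iff]
  rintro _ ⟨s, rfl⟩
  exact hφ s

theorem isDomain_coordinateRing (hc : Function.Surjective fun y s => c s y) :
    IsDomain (coordinateRing c) := by
  have aeval_injective : Function.Injective (MvPolynomial.aeval (R := ℂ) c) := by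
    refine (injective_iff_map_eq_zero _).mpr fun p hp => MvPolynomial.funext fun v => ?_
    obtain ⟨y, rfl⟩ := hc v
    rw [← aeval_apply_eq_eval, hp, map_zero, Pi.zero_apply]
  exact (AlgEquiv.ofInjective _ aeval_injective).symm.toMulEquiv.isDomain

end CoordinateRing

section MatrixPolynomialFunctions

theorem newtonC_apply {Y : Type} (p : ℕ → Y → ℂ) (m : ℕ) (y : Y) :
    newtonC p m y = newtonC (fun k => p k y) m :=
  map_newtonC (Pi.evalAlgHom ℂ (fun _ => ℂ) y) p m

theorem newtonP_apply {Y : Type} (n : ℕ) (p : ℕ → Y → ℂ) (y : Y) :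
    newtonP n p y = newtonP n fun k => p k y :=
  map_newtonP (Pi.evalAlgHom ℂ (fun _ => ℂ) y) n p

theorem exists_newtonP_powTrace_eq_eval {n : ℕ} {σ : Type} {c : σ → Matrix (Fin n) (Fin n) ℂ → ℂ}
    (hc : ∀ k, k + 1 < n → (fun X => powTrace X (k + 1)) ∈ coordinateRing c) :
    ∃ Q : MvPolynomial σ ℂ, ∀ X : Matrix (Fin n) (Fin n) ℂ,
      newtonP n (powTrace X) = MvPolynomial.eval (fun s => c s X) Q := by
  obtain ⟨Q, hQ⟩ := mem_coordinateRing_iff.mp (newtonP_mem (p := fun k X => powTrace X k) hc)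
  exact ⟨Q, fun X => by rw [← hQ, newtonP_apply]⟩

theorem exists_newtonP_eq_eval_traces (n : ℕ) :
    ∃ Q : MvPolynomial (Fin (n - 1)) ℂ, ∀ X : Matrix (Fin n) (Fin n) ℂ,
      newtonP n (powTrace X) =
        MvPolynomial.eval (fun i : Fin (n - 1) => (X ^ ((i : ℕ) + 1)).trace) Q := by
  let traces (i : Fin (n - 1)) (X : Matrix (Fin n) (Fin n) ℂ) : ℂ := (X ^ ((i : ℕ) + 1)).trace
  exact exists_newtonP_powTrace_eq_eval (c := traces) fun k hk =>
    coord_mem_coordinateRing traces ⟨k, by omega⟩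

theorem exists_newtonP_eq_eval_charpoly_coeff (n : ℕ) :
    ∃ Q : MvPolynomial (Fin n) ℂ, ∀ X : Matrix (Fin n) (Fin n) ℂ,
      newtonP n (powTrace X) =
        MvPolynomial.eval (fun i : Fin n => X.charpoly.coeff (i : ℕ)) Q := by
  let coeff (i : Fin n) (X : Matrix (Fin n) (Fin n) ℂ) : ℂ := X.charpoly.coeff i
  have newtonC_mem_coeff : ∀ j ≤ n, newtonC (fun k X => powTrace X k) j ∈ coordinateRing coeff := by
    intro j hj
    obtain rfl | j_pos := Nat.eq_zero_or_pos j
    · exact newtonC_zero (A := Matrix (Fin n) (Fin n) ℂ → ℂ) _ ▸ one_mem _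
    · have newtonC_eq : newtonC (fun k X => powTrace X k) j =
          (-1 : ℂ) ^ j • coeff ⟨n - j, by omega⟩ := by
        funext X
        simpa [newtonC_apply, Nat.sub_sub_self hj, coeff] using
          newtonC_powTrace_sub X (Nat.sub_le n j)
      rw [newtonC_eq]
      exact Subalgebra.smul_mem _ (coord_mem_coordinateRing coeff _) _
  exact exists_newtonP_powTrace_eq_eval (c := coeff) fun k hk =>
    mem_of_newtonC_mem newtonC_mem_coeff (by omega)

end MatrixPolynomialFunctions

section Multihomogeneous

variable {κ Y : Type*} [Fintype κ] [SMul (κ → ℂ) Y]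

/-- The functions on `Y` that are homogeneous of degree `d k` in the `k`-th scaling parameter. -/
def multihomogeneousFunctions (d : κ →₀ ℕ) : Submodule ℂ (Y → ℂ) where
  carrier := {F | ∀ (t : κ → ℂ) (y : Y), F (t • y) = (∏ k, t k ^ d k) * F y}
  zero_mem' t y := by simp
  add_mem' hF hG t y := by simp only [Pi.add_apply, hF t y, hG t y, mul_add]
  smul_mem' a F hF t y := by simp only [Pi.smul_apply, hF t y, mul_smul_comm]

theorem mem_multihomogeneousFunctions_single {k : κ} {m : ℕ} {F : Y → ℂ} :
    F ∈ multihomogeneousFunctions (Finsupp.single k m) ↔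
      ∀ (t : κ → ℂ) (y : Y), F (t • y) = t k ^ m * F y := by
  have prod_eq (t : κ → ℂ) : ∏ j, t j ^ Finsupp.single k m j = t k ^ m := by
    rw [← Finsupp.prod_pow]
    exact Finsupp.prod_single_index (pow_zero _)
  simp only [← prod_eq]
  rfl

instance : SetLike.GradedMonoid (multihomogeneousFunctions (κ := κ) (Y := Y)) where
  one_mem t y := by simp
  mul_mem d e F G hF hG t y := by
    simp only [Pi.mul_apply, hF t y, hG t y, Finsupp.add_apply, pow_add, Finset.prod_mul_distrib]
    ring

theorem eq_of_sum_multihomogeneous_eq {S : Finset (κ →₀ ℕ)} {a b : (κ →₀ ℕ) → Y → ℂ}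
    (ha : ∀ d ∈ S, a d ∈ multihomogeneousFunctions d)
    (hb : ∀ d ∈ S, b d ∈ multihomogeneousFunctions d)
    (hab : ∑ d ∈ S, a d = ∑ d ∈ S, b d) : ∀ d ∈ S, a d = b d := by
  intro d hd
  funext y
  have generating_eq : ∑ d ∈ S, MvPolynomial.monomial d (a d y) =
      ∑ d ∈ S, MvPolynomial.monomial d (b d y) := by
    refine MvPolynomial.funext fun t => ?_
    have eval_generating {c : (κ →₀ ℕ) → Y → ℂ}
        (hc : ∀ d ∈ S, c d ∈ multihomogeneousFunctions d) :
        MvPolynomial.eval t (∑ d ∈ S, MvPolynomial.monomial d (c d y)) =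
          (∑ d ∈ S, c d) (t • y) := by
      rw [map_sum, Finset.sum_apply]
      refine Finset.sum_congr rfl fun d hd => ?_
      rw [MvPolynomial.eval_monomial, Finsupp.prod_pow, hc d hd t y, mul_comm]
    rw [eval_generating ha, eval_generating hb, hab]
  classical
  simpa [MvPolynomial.coeff_sum, MvPolynomial.coeff_monomial, hd] using
    congrArg (MvPolynomial.coeff d) generating_eq

variable (κ) in
/-- A ring of functions is multigraded if it is spanned by its multihomogeneous elements. -/
def IsMultigraded (B : Subalgebra ℂ (Y → ℂ)) : Prop :=
  ⨆ d : κ →₀ ℕ, (multihomogeneousFunctions d).comap B.val.toLinearMap = ⊤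

end Multihomogeneous

section Multigrading

variable {κ : Type*} {Y : Type} [Fintype κ] [SMul (κ → ℂ) Y]

theorem isMultigraded_coordinateRing {σ : Type} {c : σ → Y → ℂ} {w : σ → κ →₀ ℕ}
    (hc : ∀ s, c s ∈ multihomogeneousFunctions (w s)) : IsMultigraded κ (coordinateRing c) := by
  refine (Submodule.eq_top_iff').mpr ?_
  rintro ⟨_, p, rfl⟩
  let ofPolynomial : MvPolynomial σ ℂ →ₐ[ℂ] coordinateRing c := (MvPolynomial.aeval c).rangeRestrict
  change ofPolynomial p ∈ _
  rw [p.as_sum, map_sum]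
  refine sum_mem fun e _ => Submodule.mem_iSup_of_mem (∑ s ∈ e.support, e s • w s) ?_
  change MvPolynomial.aeval c (MvPolynomial.monomial e (p.coeff e)) ∈ multihomogeneousFunctions _
  rw [MvPolynomial.aeval_monomial, ← Algebra.smul_def]
  exact Submodule.smul_mem _ _ (SetLike.prod_pow_mem_graded _ _ _ _ fun s _ => hc s)

theorem IsMultigraded.inf_invariantFunctions {G : Type} {act : G → Y → Y}
    {B : Subalgebra ℂ (Y → ℂ)} (hB : IsMultigraded κ B)
    (act_smul : ∀ g (t : κ → ℂ) y, act g (t • y) = t • act g y) :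
    IsMultigraded κ (B ⊓ invariantFunctions act) := by
  refine (Submodule.eq_top_iff').mpr fun f => ?_
  obtain ⟨c, hc, sum_c⟩ := (Submodule.mem_iSup_iff_exists_finsupp _ _).mp
    ((Submodule.eq_top_iff').mp hB ⟨f, f.2.1⟩)
  replace hc (d : κ →₀ ℕ) : (c d : Y → ℂ) ∈ multihomogeneousFunctions d := hc d
  replace sum_c : ∑ d ∈ c.support, (c d : Y → ℂ) = f := by
    simpa [Finsupp.sum] using congrArg Subtype.val sum_c
  have comp_act_eq (g : G) : ∀ d ∈ c.support, (c d : Y → ℂ) ∘ act g = c d := by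
    refine eq_of_sum_multihomogeneous_eq (fun d _ t y => ?_) (fun d _ => hc d) ?_
    · rw [Function.comp_apply, act_smul, hc d t (act g y), Function.comp_apply]
    · rw [sum_c]
      funext y
      rw [← f.2.2 g y, ← sum_c]
      simp only [Finset.sum_apply, Function.comp_apply]
  have f_eq : f = ∑ d ∈ c.support.attach,
      ⟨c d, (c d).2, fun g y => congrFun (comp_act_eq g d d.2) y⟩ := by
    refine Subtype.ext ?_
    rw [AddSubmonoidClass.coe_finsetSum, ← sum_c]
    exact (Finset.sum_attach c.support fun d => (c d : Y → ℂ)).symm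
  rw [f_eq]
  exact sum_mem fun d _ => Submodule.mem_iSup_of_mem (d : κ →₀ ℕ) (hc d)

end Multigrading

section Balanced

variable {κ Y : Type*} [Fintype κ] [SMul (κ → ℂ) Y]

/-- The functions `F` for which `F (t • y)` is `∏ k, t k ^ (n * M k)` times a polynomial in `t` of
degree at most `n - 1` in each variable. Such a function is determined on each orbit by the
scalings with `n`-th roots of unity. -/
def balancedFunctions (n : ℕ) (M : κ → ℕ) : Submodule ℂ (Y → ℂ) where
  carrier := {F | ∀ y, ∃ q ∈ MvPolynomial.restrictDegree κ ℂ (n - 1),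
    ∀ t : κ → ℂ, F (t • y) = (∏ k, t k ^ (n * M k)) * MvPolynomial.eval t q}
  zero_mem' y := ⟨0, zero_mem _, by simp⟩
  add_mem' hF hG y := by
    obtain ⟨p, hp, hFp⟩ := hF y
    obtain ⟨q, hq, hGq⟩ := hG y
    exact ⟨p + q, add_mem hp hq, fun t => by simp [hFp, hGq, mul_add]⟩
  smul_mem' a F hF y := by
    obtain ⟨p, hp, hFp⟩ := hF y
    exact ⟨a • p, Submodule.smul_mem _ a hp, fun t => by simp [hFp, mul_left_comm]⟩

variable {n : ℕ} {M : κ → ℕ} {F : Y → ℂ}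

theorem comp_mem_balancedFunctions (hF : F ∈ balancedFunctions n M) {φ : Y → Y}
    (hφ : ∀ (t : κ → ℂ) y, φ (t • y) = t • φ y) : F ∘ φ ∈ balancedFunctions n M := by
  intro y
  obtain ⟨q, hq, hFq⟩ := hF (φ y)
  exact ⟨q, hq, fun t => by rw [Function.comp_apply, hφ, hFq]⟩

theorem multihomogeneousFunctions_le_balancedFunctions [NeZero n] {d : κ →₀ ℕ}
    (hd : ∀ k, d k / n = M k) :
    multihomogeneousFunctions d ≤ (balancedFunctions n M : Submodule ℂ (Y → ℂ)) := by
  intro F hF y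
  refine ⟨MvPolynomial.monomial (d.mapRange (· % n) (Nat.zero_mod n)) (F y), ?_, fun t => ?_⟩
  · refine (MvPolynomial.mem_restrictDegree _ _ _).mpr fun e he k => ?_
    rw [Finset.mem_singleton.mp (MvPolynomial.support_monomial_subset he)]
    exact Nat.le_sub_one_of_lt (Nat.mod_lt _ (NeZero.pos n))
  · rw [hF t y, MvPolynomial.eval_monomial, Finsupp.prod_pow, mul_left_comm,
      ← Finset.prod_mul_distrib, mul_comm]
    simp only [Finsupp.mapRange_apply, ← pow_add, ← hd, Nat.div_add_mod]

theorem apply_smul_eq_zero_of_mem_balancedFunctions [NeZero n] (hF : F ∈ balancedFunctions n M)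
    {y : Y} (hy : ∀ z : κ → ℂ, (∀ k, z k ^ n = 1) → F (z • y) = 0) (t : κ → ℂ) :
    F (t • y) = 0 := by
  obtain ⟨q, q_mem, hFq⟩ := hF y
  suffices q = 0 by rw [hFq, this, map_zero, mul_zero]
  refine MvPolynomial.eq_zero_of_eval_zero_at_prod_finset q
    (fun _ => Polynomial.nthRootsFinset n (1 : ℂ)) (fun k => ?_) fun z hz => ?_
  · rw [(Complex.isPrimitiveRoot_exp n (NeZero.ne n)).card_nthRootsFinset]
    refine (MvPolynomial.degreeOf_lt_iff (NeZero.pos n)).mpr fun e he => ?_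
    exact Nat.lt_of_le_sub_one (NeZero.pos n)
      ((MvPolynomial.mem_restrictDegree _ _ _).mp q_mem e he k)
  · have z_pow (k : κ) : z k ^ n = 1 := (Polynomial.mem_nthRootsFinset (NeZero.pos n) 1).mp (hz k)
    simpa [hFq, pow_mul, z_pow] using hy z z_pow

theorem exists_balanced_sub_mem [NeZero n] {B : Subalgebra ℂ (Y → ℂ)} {I : Ideal B} {u : κ → B}
    (hu : ∀ k, (u k : Y → ℂ) ∈ multihomogeneousFunctions (Finsupp.single k n))
    (huI : ∀ k, u k - 1 ∈ I) {d : κ →₀ ℕ} {f : B} (hf : (f : Y → ℂ) ∈ multihomogeneousFunctions d)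
    (hM : ∀ k, d k / n ≤ M k) :
    ∃ F : B, (F : Y → ℂ) ∈ balancedFunctions n M ∧ f - F ∈ I := by
  let F : B := f * ∏ k, u k ^ (M k - d k / n)
  let degree : κ →₀ ℕ := d + ∑ k, (M k - d k / n) • Finsupp.single k n
  have degree_div (k : κ) : degree k / n = M k := by
    have degree_eq : degree k = d k + n * (M k - d k / n) := by
      classical
      simp [degree, Finsupp.single_apply, mul_comm]
    rw [degree_eq, Nat.add_mul_div_left _ _ (NeZero.pos n), Nat.add_sub_cancel' (hM k)]
  refine ⟨F, multihomogeneousFunctions_le_balancedFunctions degree_div ?_, ?_⟩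
  · have coe_F : (F : Y → ℂ) = f * ∏ k, (u k : Y → ℂ) ^ (M k - d k / n) := by simp [F]
    rw [coe_F]
    exact SetLike.mul_mem_graded hf (SetLike.prod_pow_mem_graded _ _ _ _ fun k _ => hu k)
  · have mk_u (k : κ) : Ideal.Quotient.mk I (u k) = 1 := by
      rw [← map_one (Ideal.Quotient.mk I), Ideal.Quotient.mk_eq_mk_iff_sub_mem]
      exact huI k
    rw [← Ideal.Quotient.mk_eq_mk_iff_sub_mem]
    simp [F, mk_u]

theorem eventually_exists_balanced_sub_mem [NeZero n] {B : Subalgebra ℂ (Y → ℂ)}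
    (hB : IsMultigraded κ B) {I : Ideal B} {u : κ → B}
    (hu : ∀ k, (u k : Y → ℂ) ∈ multihomogeneousFunctions (Finsupp.single k n))
    (huI : ∀ k, u k - 1 ∈ I) (f : B) :
    ∀ᶠ M : κ → ℕ in Filter.atTop, ∃ F : B, (F : Y → ℂ) ∈ balancedFunctions n M ∧ f - F ∈ I := by
  have hf : f ∈ ⨆ d : κ →₀ ℕ, (multihomogeneousFunctions d).comap B.val.toLinearMap :=
    (Submodule.eq_top_iff').mp hB f
  induction hf using Submodule.iSup_induction' with
  | mem d f hf =>
    filter_upwards [Filter.eventually_ge_atTop fun k => d k / n] with M hM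
    exact exists_balanced_sub_mem hu huI hf hM
  | zero => exact .of_forall fun M => ⟨0, zero_mem _, by simp⟩
  | add f g _ _ hf hg =>
    filter_upwards [hf, hg] with M ⟨F, hF, hfF⟩ ⟨G, hG, hgG⟩
    exact ⟨F + G, add_mem hF hG, by simpa only [add_sub_add_comm] using add_mem hfF hgG⟩

end Balanced

section MatrixTuples

variable {n r : ℕ}

/-- The inclusion of `SL(n, ℂ)^r` into `gl(n, ℂ)^r`. -/
def toGlTuple (x : SLTuple n r) : GlTuple n r :=
  fun k => (x k : Matrix (Fin n) (Fin n) ℂ)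

theorem toGlTuple_slConj (g : SpecialLinearGroup (Fin n) ℂ) (x : SLTuple n r) :
    toGlTuple (slConj n r g x) = glConj n r (SpecialLinearGroup.toGL g) (toGlTuple x) := by
  funext k
  simp only [toGlTuple, slConj, glConj, ← map_inv]
  rfl

theorem exists_smul_toGlTuple [NeZero n] {X : GlTuple n r} (hX : ∀ k, (X k).det ≠ 0) :
    ∃ (t : Fin r → ℂ) (x : SLTuple n r), (∀ k, t k ≠ 0) ∧ X = t • toGlTuple x := by
  choose t ht using fun k => IsAlgClosed.exists_pow_nat_eq (X k).det (NeZero.pos n)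
  have t_ne_zero (k : Fin r) : t k ≠ 0 := fun h => hX k (by rw [← ht, h, zero_pow (NeZero.ne n)])
  refine ⟨t, fun k => ⟨(t k)⁻¹ • X k, ?_⟩, t_ne_zero, funext fun k => ?_⟩
  · rw [det_smul, Fintype.card_fin, ← ht, ← mul_pow, inv_mul_cancel₀ (t_ne_zero k), one_pow]
  · exact (smul_inv_smul₀ (t_ne_zero k) (X k)).symm

theorem glConj_smul (g : GL (Fin n) ℂ) (t : Fin r → ℂ) (X : GlTuple n r) :
    glConj n r g (t • X) = t • glConj n r g X := by
  funext k
  simp [glConj]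

theorem glConj_eq_of_eq_smul {g h : GL (Fin n) ℂ} {t : ℂ} (ht : t ≠ 0)
    (hg : (g : Matrix (Fin n) (Fin n) ℂ) = t • (h : Matrix (Fin n) (Fin n) ℂ)) :
    glConj n r g = glConj n r h := by
  have inv_eq : ((g⁻¹ : GL (Fin n) ℂ) : Matrix (Fin n) (Fin n) ℂ) =
      t⁻¹ • ((h⁻¹ : GL (Fin n) ℂ) : Matrix (Fin n) (Fin n) ℂ) := by
    refine Units.inv_eq_of_mul_eq_one_right ?_
    rw [hg, smul_mul_smul_comm, mul_inv_cancel₀ ht, one_smul, Units.mul_inv]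
  funext X k
  simp only [glConj, hg, inv_eq, smul_mul_assoc, mul_smul_comm, smul_smul,
    inv_mul_cancel₀ ht, one_smul]

theorem exists_glConj_toGL_eq [NeZero n] (g : GL (Fin n) ℂ) :
    ∃ h : SpecialLinearGroup (Fin n) ℂ, glConj n r g = glConj n r (SpecialLinearGroup.toGL h) := by
  have det_ne_zero : (g : Matrix (Fin n) (Fin n) ℂ).det ≠ 0 :=
    ((isUnit_iff_isUnit_det _).mp g.isUnit).ne_zero
  obtain ⟨t, h, ht, hg⟩ := exists_smul_toGlTuple (r := 1) fun _ => det_ne_zero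
  exact ⟨h 0, glConj_eq_of_eq_smul (ht 0) (congrFun hg 0)⟩

theorem comp_glConj_mem_coordinateRing {F : GlTuple n r → ℂ} (hF : F ∈ coordinateRing (glCoord n r))
    (g : GL (Fin n) ℂ) : F ∘ glConj n r g ∈ coordinateRing (glCoord n r) := by
  refine comp_mem_coordinateRing (fun s => ?_) hF
  have coord_comp_eq : glCoord n r s ∘ glConj n r g =
      ∑ j, ∑ i, ((g : Matrix (Fin n) (Fin n) ℂ) s.2.1 i *
        ((g⁻¹ : GL (Fin n) ℂ) : Matrix (Fin n) (Fin n) ℂ) j s.2.2) • glCoord n r (s.1, i, j) := by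
    funext X
    simp [glCoord, glConj, Matrix.mul_apply, Finset.sum_mul, mul_right_comm]
  rw [coord_comp_eq]
  exact sum_mem fun j _ => sum_mem fun i _ =>
    Subalgebra.smul_mem _ (coord_mem_coordinateRing _ _) _

theorem comp_toGlTuple_mem_coordinateRing {F : GlTuple n r → ℂ}
    (hF : F ∈ coordinateRing (glCoord n r)) : F ∘ toGlTuple ∈ coordinateRing (slCoord n r) :=
  comp_mem_coordinateRing (fun s => coord_mem_coordinateRing (slCoord n r) s) hF

theorem det_mem (n r : ℕ) (k : Fin r) :
    (fun X : GlTuple n r => (X k).det) ∈ GlQuotientRing n r := by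
  refine ⟨?_, fun g X => det_units_conj g (X k)⟩
  have det_eq : (fun X : GlTuple n r => (X k).det) = ∑ σ : Equiv.Perm (Fin n),
      ((Equiv.Perm.sign σ : ℤ) : ℂ) • ∏ i, glCoord n r (k, σ i, i) := by
    funext X
    simp [det_apply', glCoord]
  rw [det_eq]
  exact sum_mem fun σ _ => Subalgebra.smul_mem _
    (prod_mem fun i _ => coord_mem_coordinateRing _ _) _

/-- `det(X_k)` as an element of `ℂ[gl(n, ℂ)^r // GL(n, ℂ)]`. -/
noncomputable def detInvariant (n r : ℕ) (k : Fin r) : GlQuotientRing n r :=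
  ⟨fun X => (X k).det, det_mem n r k⟩

theorem detInvariant_mem_multihomogeneousFunctions (k : Fin r) :
    (detInvariant n r k : GlTuple n r → ℂ) ∈ multihomogeneousFunctions (Finsupp.single k n) :=
  mem_multihomogeneousFunctions_single.mpr fun t X => by simp [detInvariant]

theorem glCoord_mem_multihomogeneousFunctions (s : Fin r × Fin n × Fin n) :
    glCoord n r s ∈ multihomogeneousFunctions (Finsupp.single s.1 1) :=
  mem_multihomogeneousFunctions_single.mpr fun t X => by simp [glCoord]

theorem isMultigraded_coordinateRing_glCoord (n r : ℕ) :
    IsMultigraded (Fin r) (coordinateRing (glCoord n r)) :=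
  isMultigraded_coordinateRing glCoord_mem_multihomogeneousFunctions

theorem isMultigraded_glQuotientRing (n r : ℕ) : IsMultigraded (Fin r) (GlQuotientRing n r) :=
  (isMultigraded_coordinateRing_glCoord n r).inf_invariantFunctions glConj_smul

end MatrixTuples

section Uniqueness

variable {n r : ℕ} {F : GlTuple n r → ℂ}

theorem eq_zero_of_eq_zero_of_det_ne_zero (hF : F ∈ coordinateRing (glCoord n r))
    (h : ∀ X : GlTuple n r, (∀ k, (X k).det ≠ 0) → F X = 0) : F = 0 := by
  have := isDomain_coordinateRing (c := glCoord n r) fun v =>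
    ⟨fun k => Matrix.of fun i j => v (k, i, j), rfl⟩
  let D : coordinateRing (glCoord n r) := ∏ k, ⟨fun X => (X k).det, (det_mem n r k).1⟩
  have D_apply (X : GlTuple n r) : (D : GlTuple n r → ℂ) X = ∏ k, (X k).det := by simp [D]
  have D_ne_zero : D ≠ 0 := by
    intro hD
    simpa [hD] using D_apply 1
  have mul_D_eq_zero : (⟨F, hF⟩ : coordinateRing (glCoord n r)) * D = 0 := by
    refine Subtype.ext (funext fun X => ?_)
    change F X * (D : GlTuple n r → ℂ) X = 0
    by_cases hX : ∀ k, (X k).det ≠ 0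
    · rw [h X hX, zero_mul]
    · obtain ⟨k, hk⟩ := not_forall_not.mp hX
      rw [D_apply, Finset.prod_eq_zero (Finset.mem_univ k) hk, mul_zero]
  exact congrArg Subtype.val ((mul_eq_zero.mp mul_D_eq_zero).resolve_right D_ne_zero)

theorem eq_zero_of_comp_toGlTuple_eq_zero [NeZero n] {M : Fin r → ℕ}
    (hF : F ∈ coordinateRing (glCoord n r)) (hFM : F ∈ balancedFunctions n M)
    (hFx : F ∘ toGlTuple = 0) : F = 0 := by
  refine eq_zero_of_eq_zero_of_det_ne_zero hF fun X hX => ?_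
  obtain ⟨t, x, -, rfl⟩ := exists_smul_toGlTuple hX
  refine apply_smul_eq_zero_of_mem_balancedFunctions hFM (fun z hz => ?_) t
  let zx : SLTuple n r := fun k => ⟨z k • (x k : Matrix (Fin n) (Fin n) ℂ), by
    rw [det_smul, Fintype.card_fin, hz k, one_mul, (x k).det_coe]⟩
  exact congrFun hFx zx

end Uniqueness

section Restriction

variable {n r : ℕ}

/-- Restriction of invariant polynomial functions from `gl(n, ℂ)^r` to `SL(n, ℂ)^r`. -/
noncomputable def restriction (n r : ℕ) : GlQuotientRing n r →ₐ[ℂ] SLQuotientRing n r :=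
  ((pullback toGlTuple).comp (GlQuotientRing n r).val).codRestrict (SLQuotientRing n r) fun f =>
    ⟨comp_toGlTuple_mem_coordinateRing f.2.1,
      fun g x => (congrArg f.1 (toGlTuple_slConj g x)).trans (f.2.2 _ _)⟩

theorem tracePow_sub_newtonP (n r : ℕ) (k : Fin r) :
    tracePow n r k n - newtonP n (tracePow n r k) =
      (-((-1) ^ n * (n : ℂ))) • (detInvariant n r k - 1) := by
  refine Subtype.ext (funext fun X => ?_)
  have newtonP_eq : (newtonP n (tracePow n r k)).1 X = newtonP n (powTrace (X k)) :=
    map_newtonP ((Pi.evalAlgHom ℂ (fun _ => ℂ) X).comp (GlQuotientRing n r).val) n _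
  change ((X k) ^ n).trace - (newtonP n (tracePow n r k)).1 X =
    (-((-1) ^ n * (n : ℂ))) * ((X k).det - 1)
  rw [newtonP_eq, newtonP_powTrace]
  ring

theorem detInvariant_sub_one_mem_unimodularIdeal [NeZero n] (k : Fin r) :
    detInvariant n r k - 1 ∈ unimodularIdeal n r := by
  have generator_mem : tracePow n r k n - newtonP n (tracePow n r k) ∈ unimodularIdeal n r :=
    Ideal.subset_span ⟨k, rfl⟩
  have coefficient_ne_zero : -((-1) ^ n * (n : ℂ)) ≠ 0 := by simp [NeZero.ne n]
  rw [tracePow_sub_newtonP] at generator_mem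
  simpa only [inv_smul_smul₀ coefficient_ne_zero] using
    Submodule.smul_of_tower_mem _ (-((-1) ^ n * (n : ℂ)))⁻¹ generator_mem

theorem restriction_detInvariant (k : Fin r) : restriction n r (detInvariant n r k) = 1 :=
  Subtype.ext (funext fun x => (x k).det_coe)

theorem unimodularIdeal_le_ker_restriction (n r : ℕ) :
    unimodularIdeal n r ≤ RingHom.ker (restriction n r) := by
  rw [unimodularIdeal, Ideal.span_le]
  rintro _ ⟨k, rfl⟩
  simp only [tracePow_sub_newtonP, SetLike.mem_coe, RingHom.mem_ker, map_smul, map_sub,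
    restriction_detInvariant, map_one, sub_self, smul_zero]

theorem ker_restriction (n r : ℕ) : RingHom.ker (restriction n r) = unimodularIdeal n r := by
  refine le_antisymm (fun f hf => ?_) (unimodularIdeal_le_ker_restriction n r)
  obtain rfl | hn := eq_or_ne n 0
  · have f_eq_zero : f = 0 := Subtype.ext (funext fun X =>
      (congrArg f.1 (Subsingleton.elim X _)).trans (congrFun (congrArg Subtype.val hf) 1))
    exact f_eq_zero ▸ zero_mem _
  have : NeZero n := ⟨hn⟩
  obtain ⟨M, F, hFM, f_sub_mem⟩ := (eventually_exists_balanced_sub_mem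
    (isMultigraded_glQuotientRing n r) detInvariant_mem_multihomogeneousFunctions
    detInvariant_sub_one_mem_unimodularIdeal f).exists
  have restriction_F : restriction n r F = 0 := by
    have restriction_sub := unimodularIdeal_le_ker_restriction n r f_sub_mem
    rwa [RingHom.mem_ker, map_sub, RingHom.mem_ker.mp hf, zero_sub, neg_eq_zero]
      at restriction_sub
  have F_eq_zero : F = 0 := Subtype.ext
    (eq_zero_of_comp_toGlTuple_eq_zero F.2.1 hFM (congrArg Subtype.val restriction_F))
  simpa [F_eq_zero] using f_sub_mem

theorem exists_balanced_extension [NeZero n] {f : SLTuple n r → ℂ}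
    (hf : f ∈ coordinateRing (slCoord n r)) :
    ∃ (M : Fin r → ℕ) (F : GlTuple n r → ℂ), F ∈ coordinateRing (glCoord n r) ∧
      F ∈ balancedFunctions n M ∧ F ∘ toGlTuple = f := by
  let restrict := (pullback (toGlTuple (n := n) (r := r))).comp (coordinateRing (glCoord n r)).val
  obtain ⟨p, hp⟩ := mem_coordinateRing_iff.mp hf
  let f₀ : coordinateRing (glCoord n r) :=
    ⟨fun X => MvPolynomial.eval (fun s => glCoord n r s X) p,
      mem_coordinateRing_iff.mpr ⟨p, fun X => rfl⟩⟩
  let D (k : Fin r) : coordinateRing (glCoord n r) := ⟨detInvariant n r k, (detInvariant n r k).2.1⟩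
  obtain ⟨M, F, hFM, f₀_sub_mem⟩ := (eventually_exists_balanced_sub_mem (n := n) (u := D)
    (I := RingHom.ker restrict)
    (isMultigraded_coordinateRing_glCoord n r) detInvariant_mem_multihomogeneousFunctions
    (fun k => sub_eq_zero.mpr (funext fun x => (x k).det_coe)) f₀).exists
  refine ⟨M, F, F.2, hFM, ?_⟩
  rw [RingHom.mem_ker, map_sub, sub_eq_zero] at f₀_sub_mem
  exact f₀_sub_mem.symm.trans (funext fun x => (hp x).symm)

theorem mem_invariantFunctions_of_comp_toGlTuple [NeZero n] {M : Fin r → ℕ}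
    {F : GlTuple n r → ℂ} (hF : F ∈ coordinateRing (glCoord n r))
    (hFM : F ∈ balancedFunctions n M)
    (hFx : F ∘ toGlTuple ∈ invariantFunctions (slConj n r)) :
    F ∈ invariantFunctions (glConj n r) := by
  intro g X
  obtain ⟨h, glConj_eq⟩ := exists_glConj_toGL_eq (r := r) g
  have comp_sub_eq_zero : F ∘ glConj n r g - F = 0 := by
    refine eq_zero_of_comp_toGlTuple_eq_zero
      (sub_mem (comp_glConj_mem_coordinateRing hF g) hF)
      (sub_mem (comp_mem_balancedFunctions hFM (glConj_smul g)) hFM) (funext fun x => ?_)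
    have eq_on_SL := hFx h x
    rw [Function.comp_apply, toGlTuple_slConj, ← glConj_eq] at eq_on_SL
    exact sub_eq_zero.mpr eq_on_SL
  exact sub_eq_zero.mp (congrFun comp_sub_eq_zero X)

theorem restriction_surjective (n r : ℕ) : Function.Surjective (restriction n r) := by
  intro f
  obtain rfl | hn := eq_or_ne n 0
  · refine ⟨algebraMap ℂ _ (f.1 1), Subtype.ext (funext fun x => ?_)⟩
    exact congrArg f.1 (Subsingleton.elim 1 x)
  have : NeZero n := ⟨hn⟩
  obtain ⟨M, F, hF, hFM, hFx⟩ := exists_balanced_extension f.2.1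
  have F_invariant := mem_invariantFunctions_of_comp_toGlTuple hF hFM (hFx ▸ f.2.2)
  exact ⟨⟨F, hF, F_invariant⟩, Subtype.ext hFx⟩

end Restriction

end MatrixInvariants

theorem mainTheorem5 (n r : ℕ) :
    (∃ e : (MatrixInvariants.GlQuotientRing n r ⧸ MatrixInvariants.unimodularIdeal n r) ≃ₐ[ℂ]
        MatrixInvariants.SLQuotientRing n r,
      ∀ (f : MatrixInvariants.GlQuotientRing n r) (x : MatrixInvariants.SLTuple n r),
        (e (Ideal.Quotient.mk (MatrixInvariants.unimodularIdeal n r) f)).1 x =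
          f.1 (fun k => (x k : Matrix (Fin n) (Fin n) ℂ))) ∧
    (∀ X : Matrix (Fin n) (Fin n) ℂ,
      MatrixInvariants.newtonP n (MatrixInvariants.powTrace X) =
        (X ^ n).trace + (-1) ^ n * (n : ℂ) * (X.det - 1)) ∧
    (∀ (X : Matrix (Fin n) (Fin n) ℂ) (k : ℕ), k ≤ n →
      X.charpoly.coeff k =
        (-1) ^ (n - k) * MatrixInvariants.newtonC (MatrixInvariants.powTrace X) (n - k)) ∧
    (∃ Q : MvPolynomial (Fin (n - 1)) ℂ, ∀ X : Matrix (Fin n) (Fin n) ℂ,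
      MatrixInvariants.newtonP n (MatrixInvariants.powTrace X) =
        MvPolynomial.eval (fun i : Fin (n - 1) => (X ^ ((i : ℕ) + 1)).trace) Q) ∧
    (∃ Q : MvPolynomial (Fin n) ℂ, ∀ X : Matrix (Fin n) (Fin n) ℂ,
      MatrixInvariants.newtonP n (MatrixInvariants.powTrace X) =
        MvPolynomial.eval (fun i : Fin n => X.charpoly.coeff (i : ℕ)) Q) := by
  exact ⟨⟨(Ideal.quotientEquivAlgOfEq ℂ (MatrixInvariants.ker_restriction n r).symm).trans
      (Ideal.quotientKerAlgEquivOfSurjective (MatrixInvariants.restriction_surjective n r)),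
      fun f x => rfl⟩,
    MatrixInvariants.newtonP_powTrace,
    fun X k hk => MatrixInvariants.charpoly_coeff_eq_newtonC X hk,
    MatrixInvariants.exists_newtonP_eq_eval_traces n,
    MatrixInvariants.exists_newtonP_eq_eval_charpoly_coeff n⟩
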